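/- Let $K$ be a field, $P=K[x_1,\dots,x_n]$, let $I\subset P$ be an ideal such that $R=P/I$ has Krull dimension $0$ (in particular $I\neq P$ and $\dim_K R<\infty$), and let $I=\mathfrak Q_1\cap\dots\cap\mathfrak Q_s$ be its minimal primary decomposition, with $\mathfrak M_i=\operatorname{Rad}(\mathfrak Q_i)$ and $\ell_i=\dim_K(P/\mathfrak M_i)$. For $j\in\mathbb Z$ let $F_jR$ be the image in $R$ of $\{f\in P\mid f=0 \text{ or } \deg f\le j\}$, let $\operatorname{HF}^a_R(j)=\dim_K F_jR$ be the affine Hilbert function and $\Delta\operatorname{HF}^a_R(j)=\operatorname{HF}^a_R(j)-\operatorname{HF}^a_R(j-1)$, let $\operatorname{ri}(R)=\min\{i\in\mathbb Z\mid \operatorname{HF}^a_R(j)=\dim_K R\text{ for all }j\ge i\}$, and for $f\in R\setminus\{0\}$ let $\operatorname{ord}(f)$ be the integer $j$ with $f\in F_jR\setminus F_{j-1}R$. Let $\operatorname{gr}_{\mathcal F}(R)=\bigoplus_{j\in\mathbb Z}F_jR/F_{j-1}R$ be the associated graded ring. * A $0$-dimensional local ring $(A,\mathfrak m)$ is *Gorenstein*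 if $\dim_{A/\mathfrak m}\operatorname{Ann}_A(\mathfrak m)=1$. The ring $R$ is *locally Gorenstein* if $R/\mathfrak q$ is a Gorenstein local ring for every primary component $\mathfrak q$ of the zero ideal of $R$, and $R$ is a *strict Gorenstein ring* if $\operatorname{gr}_{\mathcal F}(R)$ is a local Gorenstein ring. * A *minimal $\mathfrak Q_i$-divisor* of $I$ is an ideal $J=\mathfrak Q_i'\cap\bigcap_{j\ne i}\mathfrak Q_j$, where $\mathfrak Q_i'$ is an ideal of $P$ with $\mathfrak Q_i\subsetneq\mathfrak Q_i'$ (the case $\mathfrak Q_i'=P$ is allowed), such that $\dim_K(J/I)=\ell_i$. The *separator degree* of $\mathfrak M_i/I$ is $\min_J\max\{\operatorname{ord}(f)\mid f\in (J/I)\setminus\{0\}\}$, where $J$ runs over all minimal $\mathfrak Q_i$-divisors of $I$. The ring $R$ has the *Cayley-Bacharach property (CBP)* if, for every $i=1,\dots,s$, the separator degree of $\mathfrak M_i/I$ equals $\operatorname{ri}(R)$. * The affine Hilbert function of $R$ is *symmetric* if $\Delta\operatorname{HF}^a_R(\operatorname{ri}(R)-j)=\Delta\operatorname{HF}^a_R(j)$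 for all $j\in\mathbb Z$. **Theorem 6.7 (First Characterization of Strict Gorenstein Rings).** The following conditions are equivalent: (a) $R$ is a strict Gorenstein ring. (b) $R$ has the CBP and a symmetric affine Hilbert function. If these conditions are satisfied, then $R$ is locally Gorenstein. -/

import Mathlib

open scoped DirectSum

noncomputable section

namespace AffineAlgebra

variable {K : Type*} [Field K] {n : ℕ}

/-! ### The degree filtration and the affine Hilbert function -/

/-- `F_i P`, the `K`-subspace of all polynomials all of whose terms have (total) degree `≤ i`,
for `i ∈ ℤ`. See `mem_polyFiltration` for the usual description. -/
def polyFiltration (K : Type*) [Field K] (n : ℕ) (i : ℤ) : Submodule K (MvPolynomial (Fin n) K) :=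
  MvPolynomial.restrictSupport K {m | ((m.degree : ℕ) : ℤ) ≤ i}

theorem mem_polyFiltration {i : ℤ} {f : MvPolynomial (Fin n) K} :
    f ∈ polyFiltration K n i ↔ f = 0 ∨ (f.totalDegree : ℤ) ≤ i := by
  rw [polyFiltration, MvPolynomial.mem_restrictSupport_iff]
  constructor
  · intro h
    by_cases hf : f = 0
    · exact Or.inl hf
    · right
      have hle : f.totalDegree ≤ i.toNat := by
        refine Finset.sup_le fun m hm => ?_
        have h1 : ((m.degree : ℕ) : ℤ) ≤ i := h (Finset.mem_coe.mpr hm)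
        have h2 : m.degree ≤ i.toNat := by omega
        exact h2
      obtain ⟨m, hm⟩ := MvPolynomial.support_nonempty.mpr hf
      have h1 : ((m.degree : ℕ) : ℤ) ≤ i := h (Finset.mem_coe.mpr hm)
      omega
  · rintro (rfl | h) m hm
    · simp at hm
    · have := MvPolynomial.le_totalDegree (Finset.mem_coe.mp hm)
      have h2 : m.degree ≤ f.totalDegree := this
      simp only [Set.mem_ofPred_eq]
      omega

variable (I : Ideal (MvPolynomial (Fin n) K))

/-- `F_i R`, the image of `F_i P` in `R = P/I`. -/
def degFiltration (i : ℤ) : Submodule K (MvPolynomial (Fin n) K ⧸ I) :=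
  (polyFiltration K n i).map (Ideal.Quotient.mkₐ K I).toLinearMap

theorem degFiltration_mono : Monotone (degFiltration I) := by
  intro i j hij
  refine Submodule.map_mono (MvPolynomial.restrictSupport_mono K ?_)
  intro m hm
  exact le_trans hm hij

theorem one_mem_degFiltration : (1 : MvPolynomial (Fin n) K ⧸ I) ∈ degFiltration I 0 :=
  ⟨1, mem_polyFiltration.mpr (Or.inr (by simp)), map_one (Ideal.Quotient.mkₐ K I)⟩

theorem mul_mem_degFiltration {i j : ℤ} {f g : MvPolynomial (Fin n) K ⧸ I}
    (hf : f ∈ degFiltration I i) (hg : g ∈ degFiltration I j) :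
    f * g ∈ degFiltration I (i + j) := by
  obtain ⟨f, hf, rfl⟩ := hf
  obtain ⟨g, hg, rfl⟩ := hg
  refine ⟨f * g, mem_polyFiltration.mpr ?_, map_mul (Ideal.Quotient.mkₐ K I) f g⟩
  rcases mem_polyFiltration.mp hf with rfl | hf
  · simp
  rcases mem_polyFiltration.mp hg with rfl | hg
  · simp
  right
  have := MvPolynomial.totalDegree_mul f g
  omega

/-- The affine Hilbert function `HF^a_R : ℤ → ℤ`, `i ↦ dim_K (F_i R)`. -/
def affineHilbert (i : ℤ) : ℤ := Module.finrank K (degFiltration I i)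

/-- The regularity index `ri(R) = min {i ∈ ℤ | HF^a_R(j) = dim_K R for all j ≥ i}`. -/
def regIndex : ℤ :=
  sInf {i : ℤ | ∀ j, i ≤ j →
    affineHilbert I j = Module.finrank K (MvPolynomial (Fin n) K ⧸ I)}

/-- The Castelnuovo function `Δ HF^a_R`. -/
def castelnuovo (i : ℤ) : ℤ := affineHilbert I i - affineHilbert I (i - 1)

/-- The affine Hilbert function is symmetric. -/
def HasSymmetricAffineHilbert : Prop :=
  ∀ i : ℤ, castelnuovo I (regIndex I - i) = castelnuovo I i

/-- The order of an element `f ≠ 0` of `R` with respect to the degree filtration. -/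
def filtOrder (f : MvPolynomial (Fin n) K ⧸ I) : ℤ :=
  sInf {i : ℤ | f ∈ degFiltration I i ∧ f ∉ degFiltration I (i - 1)}

/-! ### The Cayley-Bacharach property -/

open scoped Classical in
/-- `J` is a minimal `Q`-divisor of `I`, where `t` is the set of primary components of `I` and
`Q ∈ t`: one replaces `Q` by a strictly larger ideal `Q'` in the primary decomposition of `I`,
and `dim_K (J/I) = dim_K (P/Rad Q)`. Here `J/I` is the image of `J` in `P/I`.
If `I` is `0`-dimensional, `Rad Q` is the only prime ideal containing `Q`, so that `Q'` is either
contained in `Rad Q` or equal to `P`; by the dimension condition, the latter occurs if and only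
if `Q` is maximal. -/
def IsMinimalDivisor (t : Finset (Ideal (MvPolynomial (Fin n) K)))
    (Q J : Ideal (MvPolynomial (Fin n) K)) : Prop :=
  (∃ Q' : Ideal (MvPolynomial (Fin n) K), Q < Q' ∧ J = Q' ⊓ (t.erase Q).inf id) ∧
    Module.finrank K (J.map (Ideal.Quotient.mk I)) =
      Module.finrank K (MvPolynomial (Fin n) K ⧸ Q.radical)

/-- For an ideal `J̄ ≠ 0` of `R`, the number `ri(J̄) = max {ord(f) | f ∈ J̄ ∖ {0}}`. -/
def idealRegIndex (Jbar : Ideal (MvPolynomial (Fin n) K ⧸ I)) : ℤ :=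
  sSup {k : ℤ | ∃ f ∈ Jbar, f ≠ 0 ∧ k = filtOrder I f}

/-- The separator degree of the maximal ideal of `R` belonging to the primary component `Q ∈ t`
of `I`: the minimum of `ri(J̄)` over all minimal `Q`-divisors `J` of `I`. -/
def sepDegree (t : Finset (Ideal (MvPolynomial (Fin n) K)))
    (Q : Ideal (MvPolynomial (Fin n) K)) : ℤ :=
  sInf {k : ℤ | ∃ J, IsMinimalDivisor I t Q J ∧
    k = idealRegIndex I (J.map (Ideal.Quotient.mk I))}

open scoped Classical in
/-- The Cayley-Bacharach property of `R = P/I`: every maximal ideal of `R` has separator degree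
`ri(R)`. (The primary decomposition `t` of the `0`-dimensional ideal `I` is unique.) -/
def HasCBP : Prop :=
  ∀ t : Finset (Ideal (MvPolynomial (Fin n) K)), Submodule.IsMinimalPrimaryDecomposition I t →
    ∀ Q ∈ t, sepDegree I t Q = regIndex I

/-! ### The associated graded ring of the degree filtration -/

/-- The homogeneous component `F_i R / F_{i-1} R` of the associated graded ring. -/
def GrPiece (i : ℤ) : Type _ :=
  (degFiltration I i) ⧸ (degFiltration I (i - 1)).submoduleOf (degFiltration I i)

instance grPieceAddCommGroup (i : ℤ) : AddCommGroup (GrPiece I i) :=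
  inferInstanceAs (AddCommGroup
    ((degFiltration I i) ⧸ (degFiltration I (i - 1)).submoduleOf (degFiltration I i)))

instance grPieceModule (i : ℤ) : Module K (GrPiece I i) :=
  inferInstanceAs (Module K
    ((degFiltration I i) ⧸ (degFiltration I (i - 1)).submoduleOf (degFiltration I i)))

/-- The residue class map `F_i R → F_i R / F_{i-1} R`. -/
def GrPiece.mk (i : ℤ) : degFiltration I i →ₗ[K] GrPiece I i :=
  Submodule.mkQ ((degFiltration I (i - 1)).submoduleOf (degFiltration I i))

theorem GrPiece.mk_surjective (i : ℤ) : Function.Surjective (GrPiece.mk I i) :=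
  Submodule.mkQ_surjective _

theorem GrPiece.mk_eq_zero_iff {i : ℤ} (f : degFiltration I i) :
    GrPiece.mk I i f = 0 ↔ f.1 ∈ degFiltration I (i - 1) :=
  Submodule.Quotient.mk_eq_zero _

/-- The multiplication `F_i R × F_j R → F_{i+j} R / F_{i+j-1} R`, `(f, g) ↦ [f g]`. -/
def grMulAux (i j : ℤ) : degFiltration I i →ₗ[K] degFiltration I j →ₗ[K] GrPiece I (i + j) :=
  LinearMap.mk₂ K
    (fun f g => GrPiece.mk I (i + j) ⟨f.1 * g.1, mul_mem_degFiltration I f.2 g.2⟩)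
    (fun f f' g => by
      rw [← map_add]; congr 1; exact Subtype.ext (add_mul _ _ _))
    (fun c f g => by
      rw [← map_smul]; congr 1; exact Subtype.ext (smul_mul_assoc _ _ _))
    (fun f g g' => by
      rw [← map_add]; congr 1; exact Subtype.ext (mul_add _ _ _))
    (fun c f g => by
      rw [← map_smul]; congr 1; exact Subtype.ext (mul_smul_comm _ _ _))

/-- The multiplication of homogeneous elements, `[f] [g] = [f g]`; see `grMul_mk`. -/
def grMul (i j : ℤ) : GrPiece I i →ₗ[K] GrPiece I j →ₗ[K] GrPiece I (i + j) :=
  Submodule.liftQ ((degFiltration I (i - 1)).submoduleOf (degFiltration I i))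
    (LinearMap.flip (Submodule.liftQ ((degFiltration I (j - 1)).submoduleOf (degFiltration I j))
      (LinearMap.flip (grMulAux I i j)) (by
      intro g hg
      ext f
      refine (GrPiece.mk_eq_zero_iff I _).mpr ?_
      have := mul_mem_degFiltration I f.2 (Submodule.mem_comap.mp hg)
      rw [← add_sub_assoc] at this
      exact this)))
    (by
      intro f hf
      refine LinearMap.ext fun g => ?_
      obtain ⟨g, rfl⟩ := GrPiece.mk_surjective I j g
      refine (GrPiece.mk_eq_zero_iff I _).mpr ?_
      have := mul_mem_degFiltration I (Submodule.mem_comap.mp hf) g.2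
      rw [sub_add_eq_add_sub] at this
      exact this)

theorem grMul_mk {i j : ℤ} (f : degFiltration I i) (g : degFiltration I j) :
    grMul I i j (GrPiece.mk I i f) (GrPiece.mk I j g) =
      GrPiece.mk I (i + j) ⟨f.1 * g.1, mul_mem_degFiltration I f.2 g.2⟩ := rfl

theorem gradedMk_eq {i j : ℤ} (h : i = j) {f : degFiltration I i} {g : degFiltration I j}
    (hfg : f.1 = g.1) :
    GradedMonoid.mk (A := GrPiece I) i (GrPiece.mk I i f) =
      GradedMonoid.mk j (GrPiece.mk I j g) := by
  subst h
  rw [Subtype.ext hfg]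

instance grGMul : GradedMonoid.GMul (GrPiece I) where
  mul {i j} a b := grMul I i j a b

instance grGOne : GradedMonoid.GOne (GrPiece I) where
  one := GrPiece.mk I 0 ⟨1, one_mem_degFiltration I⟩

instance grCommRing : DirectSum.GCommRing (GrPiece I) where
  mul_zero a := map_zero _
  zero_mul {i j} b := LinearMap.map_zero₂ (grMul I i j) b
  mul_add a b c := map_add _ _ _
  add_mul {i j} a b c := LinearMap.map_add₂ (grMul I i j) a b c
  one_mul := by
    rintro ⟨i, a⟩
    obtain ⟨f, rfl⟩ := GrPiece.mk_surjective I _ a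
    exact gradedMk_eq I (zero_add i) (one_mul f.1)
  mul_one := by
    rintro ⟨i, a⟩
    obtain ⟨f, rfl⟩ := GrPiece.mk_surjective I _ a
    exact gradedMk_eq I (add_zero i) (mul_one f.1)
  mul_assoc := by
    rintro ⟨i, a⟩ ⟨j, b⟩ ⟨k, c⟩
    obtain ⟨f, rfl⟩ := GrPiece.mk_surjective I _ a
    obtain ⟨g, rfl⟩ := GrPiece.mk_surjective I _ b
    obtain ⟨h, rfl⟩ := GrPiece.mk_surjective I _ c
    exact gradedMk_eq I (add_assoc i j k) (mul_assoc f.1 g.1 h.1)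
  mul_comm := by
    rintro ⟨i, a⟩ ⟨j, b⟩
    obtain ⟨f, rfl⟩ := GrPiece.mk_surjective I _ a
    obtain ⟨g, rfl⟩ := GrPiece.mk_surjective I _ b
    exact gradedMk_eq I (add_comm i j) (mul_comm f.1 g.1)
  natCast m := m • GrPiece.mk I 0 ⟨1, one_mem_degFiltration I⟩
  natCast_zero := zero_smul _ _
  natCast_succ m := succ_nsmul _ _
  intCast m := m • GrPiece.mk I 0 ⟨1, one_mem_degFiltration I⟩
  intCast_ofNat m := natCast_zsmul _ _
  intCast_negSucc_ofNat m := negSucc_zsmul _ _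

/-- The associated graded ring `gr_F(R) = ⨁_{i ∈ ℤ} F_i R / F_{i-1} R`. -/
abbrev GrRing : Type _ := ⨁ i : ℤ, GrPiece I i

/-! ### Gorenstein rings -/

/-- `A` is a local ring, and its socle `Soc(A) = Ann_A(𝔪)` is a one-dimensional vector space over
the residue field `A/𝔪`. For a local ring of Krull dimension `0` (the only case in which it is
used below) this means that `A` is a local Gorenstein ring. -/
def IsZeroDimLocalGorenstein (A : Type*) [CommRing A] : Prop :=
  ∃ _ : IsLocalRing A,
    Module.finrank (A ⧸ IsLocalRing.maximalIdeal A)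
      (Submodule.torsionBySet A A (IsLocalRing.maximalIdeal A : Set A)) = 1

open scoped Classical in
/-- A `0`-dimensional ring `A` is locally Gorenstein if `A/𝔮` is a local Gorenstein ring for every
primary component `𝔮` of the zero ideal of `A`. -/
def IsLocallyGorenstein (A : Type*) [CommRing A] : Prop :=
  ∀ t : Finset (Ideal A), Submodule.IsMinimalPrimaryDecomposition (⊥ : Ideal A) t →
    ∀ q ∈ t, IsZeroDimLocalGorenstein (A ⧸ q)

/-- `R = P/I` is a strict Gorenstein ring if `gr_F(R)` is a local Gorenstein ring. -/
def IsStrictGorenstein : Prop := IsZeroDimLocalGorenstein (GrRing I)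

end AffineAlgebra

end

/-! Let `r = ri(R)`. A minimal divisor of `I` is the preimage of a minimal nonzero ideal of `R`, so
the Cayley-Bacharach property says that `F_{r-1} R` contains no nonzero ideal. On the other hand
`gr(R)` is a connected graded algebra with top degree `r`; its socle contains `gr_r`, so `gr(R)` is
Gorenstein if and only if `dim gr_r = 1` and the products `gr_j × gr_{r-j} → gr_r` are
nondegenerate.

Symmetry of the Hilbert function also gives `dim gr_r = dim gr_0 = 1`, and both conditions are
compared through a linear form `φ` on `R` with kernel `F_{r-1} R`. Under the Cayley-Bacharach
property the form `(x, y) ↦ φ (x * y)` is nondegenerate. The inclusion `F_{r-1-j} R ⊆ (F_j R)^⊥`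
always holds; equality for all `j` is the nondegeneracy of the graded pairing, and by a dimension
count it is the symmetry of the Hilbert function. Finally, multiplying `φ` by an idempotent turns
it into a nondegenerate form on a local factor of `R`, whose socle then has the dimension of its
residue field. -/

noncomputable section

namespace AffineAlgebra

/-! ### The socle of a local ring -/

theorem mem_torsionBySet_iff_mem_annihilator {A : Type*} [CommRing A] (J : Ideal A) {x : A} :
    x ∈ Submodule.torsionBySet A A (J : Set A) ↔ x ∈ J.annihilator := by
  simp [Submodule.mem_torsionBySet_iff, Submodule.mem_annihilator, mul_comm]

open IsLocalRing in
theorem isZeroDimLocalGorenstein_iff {A : Type*} [CommRing A] [IsLocalRing A] {s : A}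
    (hs : s ∈ (maximalIdeal A).annihilator) (hs0 : s ≠ 0) :
    IsZeroDimLocalGorenstein A ↔ (maximalIdeal A).annihilator ≤ Ideal.span {s} := by
  let _ := Ideal.Quotient.field (maximalIdeal A)
  let s' : Submodule.torsionBySet A A (maximalIdeal A : Set A) :=
    ⟨s, (mem_torsionBySet_iff_mem_annihilator _).mpr hs⟩
  have hs' : s' ≠ 0 := fun h => hs0 (congrArg Subtype.val h)
  rw [IsZeroDimLocalGorenstein, exists_prop_of_true ‹IsLocalRing A›,
    finrank_eq_one_iff_of_nonzero' s' hs']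
  constructor
  · intro h x hx
    obtain ⟨c, hc⟩ := h ⟨x, (mem_torsionBySet_iff_mem_annihilator _).mpr hx⟩
    obtain ⟨c, rfl⟩ := Ideal.Quotient.mk_surjective c
    exact Ideal.mem_span_singleton'.mpr ⟨c, congrArg Subtype.val hc⟩
  · rintro h ⟨x, hx⟩
    obtain ⟨c, hc⟩ :=
      Ideal.mem_span_singleton'.mp (h ((mem_torsionBySet_iff_mem_annihilator _).mp hx))
    exact ⟨Ideal.Quotient.mk _ c, Subtype.ext hc⟩

/-! ### Multiplication forms -/

section MulForm

variable {K R : Type*} [Field K] [CommRing R] [Algebra K R]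

/-- The bilinear form `(x, y) ↦ φ (x * y)` attached to a linear form `φ` on a `K`-algebra. -/
def mulForm (φ : R →ₗ[K] K) : LinearMap.BilinForm K R :=
  (LinearMap.mul K R).compr₂ φ

/-- The subspace `W` contains no nonzero ideal of the ring. If `W` is the kernel of a linear form
`φ`, this is the nondegeneracy of `mulForm φ`; if `W = F_{r-1} R` with `r = ri(R)`, it is the
Cayley-Bacharach property. -/
def ContainsNoIdeal (W : Submodule K R) : Prop :=
  ∀ J : Ideal R, J.restrictScalars K ≤ W → J = ⊥

theorem containsNoIdeal_iff {W : Submodule K R} :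
    ContainsNoIdeal W ↔ ∀ x, x ≠ 0 → ∃ y, x * y ∉ W := by
  constructor
  · intro h x hx
    by_contra! hxW
    refine hx (Ideal.span_singleton_eq_bot.mp (h _ fun y hy => ?_))
    obtain ⟨c, rfl⟩ := Ideal.mem_span_singleton.mp hy
    exact hxW c
  · intro h J hJ
    by_contra hJ0
    obtain ⟨x, hx, hx0⟩ := Submodule.exists_mem_ne_zero_of_ne_bot hJ0
    obtain ⟨y, hy⟩ := h x hx0
    exact hy (hJ (J.mul_mem_right y hx))

theorem ContainsNoIdeal.nondegenerate_mulForm {φ : R →ₗ[K] K}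
    (hφ : ContainsNoIdeal (LinearMap.ker φ)) : (mulForm φ).Nondegenerate := by
  have separating (x : R) (h : ∀ y, φ (x * y) = 0) : x = 0 := by
    by_contra hx
    obtain ⟨y, hy⟩ := containsNoIdeal_iff.mp hφ x hx
    exact hy (h y)
  exact ⟨separating, fun x h => separating x fun y => mul_comm x y ▸ h y⟩

theorem mem_orthogonal_mulForm {φ : R →ₗ[K] K} {W : Submodule K R} {x : R} :
    x ∈ (mulForm φ).orthogonal W ↔ ∀ y ∈ W, x * y ∈ LinearMap.ker φ := by
  simp only [LinearMap.BilinForm.mem_orthogonal_iff, mulForm, LinearMap.compr₂_apply,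
    LinearMap.mul_apply', LinearMap.mem_ker, mul_comm x]

theorem ContainsNoIdeal.orthogonal_ideal {φ : R →ₗ[K] K}
    (hφ : ContainsNoIdeal (LinearMap.ker φ)) (J : Ideal R) :
    (mulForm φ).orthogonal (J.restrictScalars K) = J.annihilator.restrictScalars K := by
  ext x
  rw [mem_orthogonal_mulForm, Submodule.restrictScalars_mem, Submodule.mem_annihilator]
  refine ⟨fun h y hy => ?_, fun h y hy => ?_⟩
  · by_contra hxy
    obtain ⟨z, hz⟩ := containsNoIdeal_iff.mp hφ _ hxy
    rw [smul_eq_mul, mul_assoc] at hz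
    exact hz (h _ (J.mul_mem_right z hy))
  · rw [← smul_eq_mul, h y hy]
    exact zero_mem _

theorem exists_ker_eq_of_finrank_quotient_eq_one {V : Type*} [AddCommGroup V] [Module K V]
    {W : Submodule K V} (hW : Module.finrank K (V ⧸ W) = 1) :
    ∃ φ : V →ₗ[K] K, LinearMap.ker φ = W := by
  have : Module.Finite K (V ⧸ W) := Module.finite_of_finrank_eq_succ hW
  let e : (V ⧸ W) ≃ₗ[K] K := LinearEquiv.ofFinrankEq _ _ (hW.trans (Module.finrank_self K).symm)
  exact ⟨e.toLinearMap ∘ₗ W.mkQ, by rw [LinearEquiv.ker_comp, Submodule.ker_mkQ]⟩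

open IsLocalRing in
theorem ContainsNoIdeal.isZeroDimLocalGorenstein [IsLocalRing R] [Module.Finite K R]
    {φ : R →ₗ[K] K} (hφ : ContainsNoIdeal (LinearMap.ker φ)) : IsZeroDimLocalGorenstein R := by
  refine ⟨inferInstance, ?_⟩
  let _ := Ideal.Quotient.field (maximalIdeal R)
  let m := (maximalIdeal R).restrictScalars K
  let socle := Submodule.torsionBySet R R (maximalIdeal R : Set R)
  have socle_eq : socle.restrictScalars K = (mulForm φ).orthogonal m := by
    rw [hφ.orthogonal_ideal]
    ext x
    exact mem_torsionBySet_iff_mem_annihilator _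
  have finrank_socle : Module.finrank K socle = Module.finrank K (R ⧸ maximalIdeal R) := by
    have h₁ : Module.finrank K (socle.restrictScalars K) = _ :=
      socle_eq ▸ LinearMap.BilinForm.finrank_orthogonal hφ.nondegenerate_mulForm m
    have h₂ : Module.finrank K (R ⧸ maximalIdeal R) + Module.finrank K m = _ :=
      m.finrank_quotient_add_finrank
    exact h₁.trans (by omega)
  have tower := Module.finrank_mul_finrank K (R ⧸ maximalIdeal R) socle
  rw [finrank_socle] at tower
  exact (Nat.mul_eq_left Module.finrank_pos.ne').mp tower

end MulForm

/-! ### Minimal primary decompositions -/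

section PrimaryDecomposition

variable {P : Type*} [CommRing P] {I : Ideal P} {t : Finset (Ideal P)} {Q : Ideal P}

theorem le_of_mem_decomposition (ht : Submodule.IsMinimalPrimaryDecomposition I t) (hQ : Q ∈ t) :
    I ≤ Q :=
  ht.inf_eq ▸ Finset.inf_le (f := id) hQ

theorem radical_isPrime_of_mem_decomposition
    (ht : Submodule.IsMinimalPrimaryDecomposition I t) (hQ : Q ∈ t) : Q.radical.IsPrime :=
  Ideal.isPrime_radical (ht.primary hQ)

theorem radical_injOn_decomposition (ht : Submodule.IsMinimalPrimaryDecomposition I t) :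
    Set.InjOn Ideal.radical (t : Set (Ideal P)) := by
  intro Q hQ Q' hQ' h
  by_contra hne
  exact ht.distinct hQ hQ' hne (by simpa only [Submodule.colon_univ] using h)

open scoped Classical in
theorem inf_inf_erase_eq (ht : Submodule.IsMinimalPrimaryDecomposition I t) (hQ : Q ∈ t) :
    Q ⊓ (t.erase Q).inf id = I := by
  rw [← ht.inf_eq, ← Finset.insert_erase hQ, Finset.inf_insert, id,
    Finset.erase_insert (Finset.notMem_erase Q t)]

open scoped Classical in
theorem sup_inf_erase_eq_top (hmax : ∀ p : Ideal P, p.IsPrime → I ≤ p → p.IsMaximal)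
    (ht : Submodule.IsMinimalPrimaryDecomposition I t) (hQ : Q ∈ t) :
    Q ⊔ (t.erase Q).inf id = ⊤ := by
  rw [Finset.inf_eq_iInf]
  refine Ideal.sup_iInf_eq_top fun Q' hQ' => ?_
  obtain ⟨hne, hQ't⟩ := Finset.mem_erase.mp hQ'
  have radical_isMaximal {q : Ideal P} (hq : q ∈ t) : q.radical.IsMaximal :=
    hmax _ (radical_isPrime_of_mem_decomposition ht hq)
      ((le_of_mem_decomposition ht hq).trans Ideal.le_radical)
  have coprime : Q.radical ⊔ Q'.radical = ⊤ :=
    (radical_isMaximal hQ).coprime_of_ne (radical_isMaximal hQ't) fun h =>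
      hne (radical_injOn_decomposition ht hQ hQ't h).symm
  rw [id, ← Ideal.radical_eq_top, Ideal.radical_sup, coprime, Ideal.radical_top]

end PrimaryDecomposition

/-! ### Local rings from linear forms -/

theorem isLocalRing_quotient_of_isMaximal_radical {A : Type*} [CommRing A] {q : Ideal A}
    (hq : q.radical.IsMaximal) : IsLocalRing (A ⧸ q) := by
  have ker_le : RingHom.ker (Ideal.Quotient.mk q) ≤ q := Ideal.mk_ker.le
  have map_radical : q.radical.map (Ideal.Quotient.mk q) = nilradical (A ⧸ q) := by
    rw [Ideal.map_radical_of_surjective Ideal.Quotient.mk_surjective ker_le,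
      Ideal.map_quotient_self, nilradical, Ideal.zero_eq_bot]
  have : (nilradical (A ⧸ q)).IsMaximal := map_radical ▸
    hq.map_of_surjective_of_ker_le Ideal.Quotient.mk_surjective (ker_le.trans Ideal.le_radical)
  exact IsLocalRing.of_isMaximal_nilradical _

theorem ContainsNoIdeal.exists_containsNoIdeal_quotient {K R : Type*} [Field K] [CommRing R]
    [Algebra K R] {φ : R →ₗ[K] K} (hφ : ContainsNoIdeal (LinearMap.ker φ)) {q N : Ideal R}
    (hinf : q ⊓ N = ⊥) (hsup : q ⊔ N = ⊤) :
    ∃ ψ : R ⧸ q →ₗ[K] K, ContainsNoIdeal (LinearMap.ker ψ) := by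
  -- `e` is the idempotent of `R` that belongs to the factor `R ⧸ q`.
  obtain ⟨b, hb, e, he, hbe⟩ := Submodule.mem_sup.mp ((Ideal.eq_top_iff_one _).mp hsup)
  have ker_le : q.restrictScalars K ≤ LinearMap.ker (φ ∘ₗ LinearMap.mulLeft K e) := by
    intro x hx
    have : e * x ∈ q ⊓ N := ⟨q.mul_mem_left e hx, N.mul_mem_right x he⟩
    rw [hinf, Ideal.mem_bot] at this
    simp [this]
  let ψ : R ⧸ q →ₗ[K] K := (q.restrictScalars K).liftQ _ ker_le
  have ψ_mk (x : R) : ψ (Ideal.Quotient.mk q x) = φ (e * x) := rfl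
  refine ⟨ψ, containsNoIdeal_iff.mpr fun x hx => ?_⟩
  obtain ⟨x, rfl⟩ := Ideal.Quotient.mk_surjective x
  have hex : e * x ≠ 0 := by
    intro h
    refine hx (Ideal.Quotient.eq_zero_iff_mem.mpr ?_)
    rw [← one_mul x, ← hbe, add_mul, h, add_zero]
    exact q.mul_mem_right x hb
  obtain ⟨y, hy⟩ := containsNoIdeal_iff.mp hφ _ hex
  refine ⟨Ideal.Quotient.mk q y, ?_⟩
  rwa [LinearMap.mem_ker, ← map_mul, ψ_mk, ← mul_assoc]

theorem ContainsNoIdeal.isLocallyGorenstein {K R : Type*} [Field K] [CommRing R] [Algebra K R]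
    [Module.Finite K R] {φ : R →ₗ[K] K} (hφ : ContainsNoIdeal (LinearMap.ker φ)) :
    IsLocallyGorenstein R := by
  have : IsArtinianRing R := IsArtinianRing.of_finite K R
  intro t ht q hq
  have := radical_isPrime_of_mem_decomposition ht hq
  have : IsLocalRing (R ⧸ q) := isLocalRing_quotient_of_isMaximal_radical inferInstance
  obtain ⟨ψ, hψ⟩ := hφ.exists_containsNoIdeal_quotient (inf_inf_erase_eq ht hq)
    (sup_inf_erase_eq_top (fun p _ _ => inferInstance) ht hq)
  exact hψ.isZeroDimLocalGorenstein

/-! ### Minimal divisors and minimal nonzero ideals -/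

section Atoms

variable {P : Type*} [CommRing P] {I : Ideal P} {S : Ideal (P ⧸ I)} {t : Finset (Ideal P)}
  {Q : Ideal P}

theorem map_mk_eq_bot_iff {J : Ideal P} : J.map (Ideal.Quotient.mk I) = ⊥ ↔ J ≤ I := by
  rw [Ideal.map_eq_bot_iff_le_ker, Ideal.mk_ker]

theorem comap_mk_le_iff_eq_bot : S.comap (Ideal.Quotient.mk I) ≤ I ↔ S = ⊥ := by
  rw [eq_bot_iff,
    ← Ideal.comap_le_comap_iff_of_surjective (Ideal.Quotient.mk I) Ideal.Quotient.mk_surjective,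
    ← RingHom.ker_eq_comap_bot, Ideal.mk_ker]

theorem isMaximal_annihilator_of_isAtom {R : Type*} [CommRing R] {S : Ideal R} (hS : IsAtom S) :
    S.annihilator.IsMaximal := by
  have := isSimpleModule_iff_isAtom.mpr hS
  exact IsSimpleModule.annihilator_isMaximal

theorem finrank_eq_of_isAtom {K : Type*} [Field K] [Algebra K P] (hS : IsAtom S) :
    Module.finrank K S =
      Module.finrank K (P ⧸ S.annihilator.comap (Ideal.Quotient.mk I)) := by
  have hM : (S.annihilator.comap (Ideal.Quotient.mk I)).IsMaximal :=
    have := isMaximal_annihilator_of_isAtom hS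
    Ideal.comap_isMaximal_of_surjective _ Ideal.Quotient.mk_surjective
  have := isSimpleModule_iff_isAtom.mpr hS
  have := IsSimpleModule.nontrivial (P ⧸ I) S
  obtain ⟨m, hm⟩ := exists_ne (0 : S)
  let f : P →ₗ[P] S := LinearMap.toSpanSingleton P S m
  have f_surjective : Function.Surjective f := fun x => by
    obtain ⟨a, rfl⟩ := IsSimpleModule.toSpanSingleton_surjective (P ⧸ I) hm x
    obtain ⟨a, rfl⟩ := Ideal.Quotient.mk_surjective a
    exact ⟨a, rfl⟩
  have ker_f : S.annihilator.comap (Ideal.Quotient.mk I) = LinearMap.ker f := by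
    refine hM.eq_of_le (fun h => hm ?_) fun a ha => ?_
    · rw [← one_smul P m]
      exact (Ideal.eq_top_iff_one _).mp h
    · exact Subtype.ext (Submodule.mem_annihilator.mp ha m m.2)
  rw [ker_f]
  exact ((f.quotKerEquivOfSurjective f_surjective).restrictScalars K).finrank_eq.symm

theorem radical_eq_comap_annihilator (ht : Submodule.IsMinimalPrimaryDecomposition I t)
    (hQ : Q ∈ t) (hS : IsAtom S) (hSQ : ¬ S.comap (Ideal.Quotient.mk I) ≤ Q) :
    Q.radical = S.annihilator.comap (Ideal.Quotient.mk I) := by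
  have := isMaximal_annihilator_of_isAtom hS
  have hM : (S.annihilator.comap (Ideal.Quotient.mk I)).IsMaximal :=
    Ideal.comap_isMaximal_of_surjective _ Ideal.Quotient.mk_surjective
  obtain ⟨y, hyS, hyQ⟩ := SetLike.not_le_iff_exists.mp hSQ
  refine (hM.eq_of_le (radical_isPrime_of_mem_decomposition ht hQ).ne_top fun a ha => ?_).symm
  have hya : y * a ∈ Q := by
    refine le_of_mem_decomposition ht hQ (Ideal.Quotient.eq_zero_iff_mem.mp ?_)
    rw [mul_comm, map_mul]
    exact Submodule.mem_annihilator.mp ha _ hyS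
  exact ((Ideal.isPrimary_iff.mp (ht.primary hQ)).2 hya).resolve_left hyQ

open scoped Classical in
theorem comap_le_inf_erase_of_isAtom (ht : Submodule.IsMinimalPrimaryDecomposition I t)
    (hQ : Q ∈ t) (hS : IsAtom S) (hSQ : ¬ S.comap (Ideal.Quotient.mk I) ≤ Q) :
    S.comap (Ideal.Quotient.mk I) ≤ (t.erase Q).inf id := by
  refine Finset.le_inf fun Q' hQ' => ?_
  obtain ⟨hne, hQ't⟩ := Finset.mem_erase.mp hQ'
  by_contra hSQ'
  exact hne (radical_injOn_decomposition ht hQ't hQ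
    ((radical_eq_comap_annihilator ht hQ't hS hSQ').trans
      (radical_eq_comap_annihilator ht hQ hS hSQ).symm))

theorem isMaximal_of_isPrime_of_le [IsArtinianRing (P ⧸ I)] {p : Ideal P} (hp : p.IsPrime)
    (hIp : I ≤ p) : p.IsMaximal := by
  have : (p.map (Ideal.Quotient.mk I)).IsPrime :=
    Ideal.map_isPrime_of_surjective Ideal.Quotient.mk_surjective (Ideal.mk_ker.trans_le hIp)
  exact Ideal.comap_map_mk hIp ▸
    Ideal.comap_isMaximal_of_surjective _ Ideal.Quotient.mk_surjective

end Atoms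

section MinimalDivisor

variable {K : Type*} [Field K] {n : ℕ} {I : Ideal (MvPolynomial (Fin n) K)}
  {t : Finset (Ideal (MvPolynomial (Fin n) K))} {Q : Ideal (MvPolynomial (Fin n) K)}
  {S : Ideal (MvPolynomial (Fin n) K ⧸ I)}

theorem isMinimalDivisor_comap_of_isAtom (ht : Submodule.IsMinimalPrimaryDecomposition I t)
    (hQ : Q ∈ t) (hS : IsAtom S) (hSQ : ¬ S.comap (Ideal.Quotient.mk I) ≤ Q) :
    IsMinimalDivisor I t Q (S.comap (Ideal.Quotient.mk I)) := by
  classical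
  refine ⟨⟨S.comap (Ideal.Quotient.mk I) ⊔ Q, right_lt_sup.mpr hSQ, ?_⟩, ?_⟩
  · rw [sup_inf_assoc_of_le _ (comap_le_inf_erase_of_isAtom ht hQ hS hSQ),
      inf_inf_erase_eq ht hQ, left_eq_sup]
    exact Ideal.mk_ker.symm.trans_le (Ideal.comap_mono bot_le)
  · rw [Ideal.map_comap_of_surjective _ Ideal.Quotient.mk_surjective, finrank_eq_of_isAtom hS,
      radical_eq_comap_annihilator ht hQ hS hSQ]

variable [IsArtinianRing (MvPolynomial (Fin n) K ⧸ I)]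

theorem exists_isMinimalDivisor_map_le (ht : Submodule.IsMinimalPrimaryDecomposition I t)
    (hS : S ≠ ⊥) :
    ∃ Q ∈ t, ∃ J, IsMinimalDivisor I t Q J ∧ J.map (Ideal.Quotient.mk I) ≤ S := by
  obtain ⟨S', hS', hle⟩ := (eq_bot_or_exists_atom_le S).resolve_left hS
  obtain ⟨Q, hQ, hSQ⟩ : ∃ Q ∈ t, ¬ S'.comap (Ideal.Quotient.mk I) ≤ Q := by
    by_contra! h
    exact hS'.1 (comap_mk_le_iff_eq_bot.mp ((Finset.le_inf h).trans ht.inf_eq.le))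
  exact ⟨Q, hQ, _, isMinimalDivisor_comap_of_isAtom ht hQ hS' hSQ, Ideal.map_comap_le.trans hle⟩

theorem exists_isMinimalDivisor (ht : Submodule.IsMinimalPrimaryDecomposition I t) (hQ : Q ∈ t) :
    ∃ J, IsMinimalDivisor I t Q J := by
  classical
  set N := (t.erase Q).inf id
  have map_ne_bot : N.map (Ideal.Quotient.mk I) ≠ ⊥ := fun h =>
    ht.minimal hQ ((map_mk_eq_bot_iff.mp h).trans (le_of_mem_decomposition ht hQ))
  obtain ⟨S, hS, hle⟩ := (eq_bot_or_exists_atom_le _).resolve_left map_ne_bot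
  have comap_le : S.comap (Ideal.Quotient.mk I) ≤ N := by
    have hIN : I ≤ N := (inf_inf_erase_eq ht hQ).symm.trans_le inf_le_right
    exact (Ideal.comap_mono hle).trans (Ideal.comap_map_mk hIN).le
  refine ⟨_, isMinimalDivisor_comap_of_isAtom ht hQ hS fun hSQ => hS.1 ?_⟩
  exact comap_mk_le_iff_eq_bot.mp ((le_inf hSQ comap_le).trans (inf_inf_erase_eq ht hQ).le)

theorem IsMinimalDivisor.map_ne_bot {J : Ideal (MvPolynomial (Fin n) K)}
    (hJ : IsMinimalDivisor I t Q J) (ht : Submodule.IsMinimalPrimaryDecomposition I t)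
    (hQ : Q ∈ t) : J.map (Ideal.Quotient.mk I) ≠ ⊥ := by
  classical
  obtain ⟨⟨Q', hQQ', rfl⟩, -⟩ := hJ
  set N := (t.erase Q).inf id
  intro h
  refine hQQ'.not_ge ?_
  have inf_le_Q : N ⊓ Q' ≤ Q :=
    (inf_comm N Q').trans_le ((map_mk_eq_bot_iff.mp h).trans (le_of_mem_decomposition ht hQ))
  calc Q' = (Q ⊔ N) ⊓ Q' := by
        rw [sup_inf_erase_eq_top (fun _ => isMaximal_of_isPrime_of_le) ht hQ, top_inf_eq]
    _ = Q ⊔ N ⊓ Q' := sup_inf_assoc_of_le _ hQQ'.le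
    _ ≤ Q := sup_le le_rfl inf_le_Q

end MinimalDivisor

/-! ### The degree filtration and its numerical invariants -/

section DegreeFiltration

theorem exists_eq_Ici_of_isUpperSet {s : Set ℤ} (hs : IsUpperSet s) (hne : s.Nonempty)
    (hbdd : BddBelow s) : ∃ m, s = Set.Ici m :=
  ⟨sInf s, Set.Subset.antisymm (fun _ => csInf_le hbdd) fun _ h => hs h (Int.csInf_mem hne hbdd)⟩

variable {K : Type*} [Field K] {n : ℕ} (I : Ideal (MvPolynomial (Fin n) K))

theorem degFiltration_eq_bot {j : ℤ} (hj : j < 0) : degFiltration I j = ⊥ := by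
  rw [eq_bot_iff]
  rintro _ ⟨f, hf, rfl⟩
  rcases mem_polyFiltration.mp hf with rfl | h
  · exact zero_mem _
  · omega

theorem degFiltration_zero_eq_span :
    degFiltration I 0 = Submodule.span K {(1 : MvPolynomial (Fin n) K ⧸ I)} := by
  refine le_antisymm ?_ ((Submodule.span_singleton_le_iff_mem _ _).mpr (one_mem_degFiltration I))
  rintro _ ⟨f, hf, rfl⟩
  have hf0 : f.totalDegree = 0 := by
    rcases mem_polyFiltration.mp hf with rfl | h
    · exact MvPolynomial.totalDegree_zero
    · omega
  rw [MvPolynomial.totalDegree_eq_zero_iff_eq_C.mp hf0]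
  exact Submodule.mem_span_singleton.mpr ⟨f.coeff 0, Algebra.algebraMap_eq_smul_one _ |>.symm⟩

variable {I}

theorem exists_mem_degFiltration (x : MvPolynomial (Fin n) K ⧸ I) :
    ∃ d : ℕ, x ∈ degFiltration I d := by
  obtain ⟨f, rfl⟩ := Ideal.Quotient.mk_surjective x
  exact ⟨f.totalDegree, f, mem_polyFiltration.mpr (Or.inr le_rfl), rfl⟩

theorem filtOrder_le_iff {x : MvPolynomial (Fin n) K ⧸ I} (hx : x ≠ 0) {j : ℤ} :
    filtOrder I x ≤ j ↔ x ∈ degFiltration I j := by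
  have isUpperSet : IsUpperSet {i : ℤ | x ∈ degFiltration I i} :=
    fun _ _ hij h => degFiltration_mono I hij h
  have bddBelow : BddBelow {i : ℤ | x ∈ degFiltration I i} :=
    ⟨0, fun i hi => not_lt.mp fun hneg =>
      hx ((Submodule.mem_bot K).mp (degFiltration_eq_bot I hneg ▸ hi))⟩
  obtain ⟨d, hd⟩ := exists_mem_degFiltration x
  obtain ⟨m, hm⟩ := exists_eq_Ici_of_isUpperSet isUpperSet ⟨d, hd⟩ bddBelow
  have mem_iff (i : ℤ) : x ∈ degFiltration I i ↔ m ≤ i := Set.ext_iff.mp hm i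
  have set_eq : {i : ℤ | x ∈ degFiltration I i ∧ x ∉ degFiltration I (i - 1)} = {m} := by
    ext i
    simp only [mem_iff, Set.mem_ofPred_eq, Set.mem_singleton_iff]
    omega
  rw [filtOrder, set_eq, csInf_singleton, mem_iff]

section Finite

variable [Module.Finite K (MvPolynomial (Fin n) K ⧸ I)]

variable (I) in
theorem exists_degFiltration_eq_top : ∃ d : ℕ, degFiltration I d = ⊤ := by
  obtain ⟨s, hs⟩ := Module.Finite.fg_top (R := K) (M := MvPolynomial (Fin n) K ⧸ I)
  choose d hd using exists_mem_degFiltration (I := I)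
  refine ⟨s.sup d, top_le_iff.mp (hs ▸ Submodule.span_le.mpr fun x hx => ?_)⟩
  exact degFiltration_mono I (by exact_mod_cast Finset.le_sup (f := d) hx) (hd x)

theorem idealRegIndex_le_iff {J : Ideal (MvPolynomial (Fin n) K ⧸ I)} (hJ : J ≠ ⊥) {j : ℤ} :
    idealRegIndex I J ≤ j ↔ J.restrictScalars K ≤ degFiltration I j := by
  obtain ⟨x, hxJ, hx⟩ := Submodule.exists_mem_ne_zero_of_ne_bot hJ
  obtain ⟨d, hd⟩ := exists_degFiltration_eq_top I
  have bddAbove : BddAbove {k : ℤ | ∃ f ∈ J, f ≠ 0 ∧ k = filtOrder I f} := by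
    refine ⟨d, ?_⟩
    rintro _ ⟨f, -, hf, rfl⟩
    exact (filtOrder_le_iff hf).mpr (hd ▸ Submodule.mem_top)
  rw [idealRegIndex, csSup_le_iff bddAbove ⟨_, x, hxJ, hx, rfl⟩]
  constructor
  · intro h f hf
    rcases eq_or_ne f 0 with rfl | hf0
    · exact zero_mem _
    · exact (filtOrder_le_iff hf0).mp (h _ ⟨f, hf, hf0, rfl⟩)
  · rintro h _ ⟨f, hf, hf0, rfl⟩
    exact (filtOrder_le_iff hf0).mpr (h hf)

theorem idealRegIndex_nonneg {J : Ideal (MvPolynomial (Fin n) K ⧸ I)} (hJ : J ≠ ⊥) :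
    0 ≤ idealRegIndex I J := by
  by_contra! hneg
  have hle := degFiltration_eq_bot I hneg ▸ (idealRegIndex_le_iff hJ).mp le_rfl
  exact hJ ((Submodule.restrictScalars_eq_bot_iff K _ _).mp (le_bot_iff.mp hle))

theorem affineHilbert_eq_finrank_iff {j : ℤ} :
    affineHilbert I j = Module.finrank K (MvPolynomial (Fin n) K ⧸ I) ↔
      degFiltration I j = ⊤ := by
  rw [affineHilbert, Nat.cast_inj]
  exact ⟨Submodule.eq_top_of_finrank_eq, fun h => h ▸ finrank_top K _⟩

theorem degFiltration_eq_top_iff [Nontrivial (MvPolynomial (Fin n) K ⧸ I)] {j : ℤ} :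
    degFiltration I j = ⊤ ↔ regIndex I ≤ j := by
  have isUpperSet : IsUpperSet {i : ℤ | degFiltration I i = ⊤} :=
    fun _ _ hij h => top_le_iff.mp (h.symm.trans_le (degFiltration_mono I hij))
  have bddBelow : BddBelow {i : ℤ | degFiltration I i = ⊤} :=
    ⟨0, fun i hi => not_lt.mp fun hneg => bot_ne_top ((degFiltration_eq_bot I hneg).symm.trans hi)⟩
  obtain ⟨d, hd⟩ := exists_degFiltration_eq_top I
  obtain ⟨m, hm⟩ := exists_eq_Ici_of_isUpperSet isUpperSet ⟨d, hd⟩ bddBelow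
  have mem_iff (i : ℤ) : degFiltration I i = ⊤ ↔ m ≤ i := Set.ext_iff.mp hm i
  have set_eq : {i : ℤ | ∀ j, i ≤ j →
      affineHilbert I j = Module.finrank K (MvPolynomial (Fin n) K ⧸ I)} = Set.Ici m := by
    ext i
    simp only [affineHilbert_eq_finrank_iff, mem_iff, Set.mem_ofPred_eq, Set.mem_Ici]
    exact ⟨fun h => h i le_rfl, fun h j => h.trans⟩
  rw [regIndex, set_eq, csInf_Ici, mem_iff]

variable (I) in
theorem degFiltration_regIndex [Nontrivial (MvPolynomial (Fin n) K ⧸ I)] :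
    degFiltration I (regIndex I) = ⊤ :=
  degFiltration_eq_top_iff.mpr le_rfl

end Finite

end DegreeFiltration

/-! ### The Cayley-Bacharach property -/

section CayleyBacharach

variable {K : Type*} [Field K] {n : ℕ} {I : Ideal (MvPolynomial (Fin n) K)}
  [Module.Finite K (MvPolynomial (Fin n) K ⧸ I)] [Nontrivial (MvPolynomial (Fin n) K ⧸ I)]

theorem sepDegree_eq_regIndex_iff {t : Finset (Ideal (MvPolynomial (Fin n) K))}
    (ht : Submodule.IsMinimalPrimaryDecomposition I t) {Q : Ideal (MvPolynomial (Fin n) K)}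
    (hQ : Q ∈ t) :
    sepDegree I t Q = regIndex I ↔ ∀ J, IsMinimalDivisor I t Q J →
      ¬ (J.map (Ideal.Quotient.mk I)).restrictScalars K ≤ degFiltration I (regIndex I - 1) := by
  have : IsArtinianRing (MvPolynomial (Fin n) K ⧸ I) := IsArtinianRing.of_finite K _
  obtain ⟨J₀, hJ₀⟩ := exists_isMinimalDivisor ht hQ
  have bddBelow : BddBelow {k : ℤ | ∃ J, IsMinimalDivisor I t Q J ∧
      k = idealRegIndex I (J.map (Ideal.Quotient.mk I))} := by
    refine ⟨0, ?_⟩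
    rintro _ ⟨J, hJ, rfl⟩
    exact idealRegIndex_nonneg (hJ.map_ne_bot ht hQ)
  have sepDegree_le : sepDegree I t Q ≤ regIndex I :=
    csInf_le_of_le bddBelow ⟨J₀, hJ₀, rfl⟩ <|
      (idealRegIndex_le_iff (hJ₀.map_ne_bot ht hQ)).mpr (degFiltration_regIndex I ▸ le_top)
  have le_idealRegIndex_iff {J} (hJ : IsMinimalDivisor I t Q J) :
      regIndex I ≤ idealRegIndex I (J.map (Ideal.Quotient.mk I)) ↔
        ¬ (J.map (Ideal.Quotient.mk I)).restrictScalars K ≤ degFiltration I (regIndex I - 1) := by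
    rw [← idealRegIndex_le_iff (hJ.map_ne_bot ht hQ), Int.le_sub_one_iff, not_lt]
  rw [eq_iff_le_not_lt, and_iff_right sepDegree_le, not_lt, sepDegree,
    le_csInf_iff bddBelow ⟨_, J₀, hJ₀, rfl⟩]
  constructor
  · intro h J hJ
    exact (le_idealRegIndex_iff hJ).mp (h _ ⟨J, hJ, rfl⟩)
  · rintro h _ ⟨J, hJ, rfl⟩
    exact (le_idealRegIndex_iff hJ).mpr (h J hJ)

theorem hasCBP_iff :
    HasCBP I ↔ ContainsNoIdeal (degFiltration I (regIndex I - 1)) := by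
  have : IsArtinianRing (MvPolynomial (Fin n) K ⧸ I) := IsArtinianRing.of_finite K _
  constructor
  · intro h S hS
    obtain ⟨t, ht⟩ :=
      Submodule.IsLasker.exists_isMinimalPrimaryDecomposition (Submodule.isLasker _ _) I
    by_contra hS0
    obtain ⟨Q, hQ, J, hJ, hJS⟩ := exists_isMinimalDivisor_map_le ht hS0
    exact (sepDegree_eq_regIndex_iff ht hQ).mp (h t ht Q hQ) J hJ (le_trans hJS hS)
  · intro h t ht Q hQ
    exact (sepDegree_eq_regIndex_iff ht hQ).mpr fun J hJ hle => hJ.map_ne_bot ht hQ (h _ hle)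

end CayleyBacharach

/-! ### The affine Hilbert function and perfect pairings -/

section Pairing

variable {K : Type*} [Field K] {n : ℕ} (I : Ideal (MvPolynomial (Fin n) K))

theorem affineHilbert_of_neg {j : ℤ} (hj : j < 0) : affineHilbert I j = 0 := by
  rw [affineHilbert, degFiltration_eq_bot I hj, finrank_bot, Nat.cast_zero]

/-- Nondegeneracy of the multiplications `gr_i × gr_{r-i} → gr_r`, where `r = ri(R)`. It is
expressed by elements of `R` instead of classes: every `x` with `x · F_j R ⊆ F_{r-1} R` lies in
`F_{r-1-j} R`. -/
def HasPerfectPairing : Prop :=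
  ∀ (j : ℤ) (x : MvPolynomial (Fin n) K ⧸ I),
    (∀ y ∈ degFiltration I j, x * y ∈ degFiltration I (regIndex I - 1)) →
      x ∈ degFiltration I (regIndex I - 1 - j)

variable {I}

theorem hasPerfectPairing_iff_orthogonal_le {φ : (MvPolynomial (Fin n) K ⧸ I) →ₗ[K] K}
    (hφ : LinearMap.ker φ = degFiltration I (regIndex I - 1)) :
    HasPerfectPairing I ↔ ∀ j,
      (mulForm φ).orthogonal (degFiltration I j) ≤ degFiltration I (regIndex I - 1 - j) := by
  simp only [HasPerfectPairing, SetLike.le_def, mem_orthogonal_mulForm, hφ]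

theorem HasPerfectPairing.containsNoIdeal (h : HasPerfectPairing I) :
    ContainsNoIdeal (degFiltration I (regIndex I - 1)) := by
  intro J hJ
  rw [eq_bot_iff]
  intro x hx
  have hx' := h (regIndex I) x fun y _ => hJ (J.mul_mem_right y hx)
  rwa [degFiltration_eq_bot I (by omega)] at hx'

section Symmetric

variable [Nontrivial (MvPolynomial (Fin n) K ⧸ I)]

variable (I) in
theorem castelnuovo_zero : castelnuovo I 0 = 1 := by
  rw [castelnuovo, affineHilbert_of_neg I (j := 0 - 1) (by norm_num), affineHilbert,
    degFiltration_zero_eq_span, finrank_span_singleton one_ne_zero, Nat.cast_one, sub_zero]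

theorem HasSymmetricAffineHilbert.castelnuovo_regIndex_eq_one (h : HasSymmetricAffineHilbert I) :
    castelnuovo I (regIndex I) = 1 := by
  rw [← castelnuovo_zero I, ← h 0, sub_zero]

variable [Module.Finite K (MvPolynomial (Fin n) K ⧸ I)]

variable (I) in
theorem castelnuovo_regIndex :
    castelnuovo I (regIndex I) = Module.finrank K
      ((MvPolynomial (Fin n) K ⧸ I) ⧸ degFiltration I (regIndex I - 1)) := by
  rw [castelnuovo, affineHilbert_eq_finrank_iff.mpr (degFiltration_regIndex I), affineHilbert,
    ← (degFiltration I (regIndex I - 1)).finrank_quotient_add_finrank]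
  push_cast
  ring

theorem exists_ker_eq_degFiltration (h : castelnuovo I (regIndex I) = 1) :
    ∃ φ : (MvPolynomial (Fin n) K ⧸ I) →ₗ[K] K,
      LinearMap.ker φ = degFiltration I (regIndex I - 1) :=
  exists_ker_eq_of_finrank_quotient_eq_one (by exact_mod_cast (castelnuovo_regIndex I).symm.trans h)

theorem hasSymmetricAffineHilbert_iff : HasSymmetricAffineHilbert I ↔
    ∀ j, affineHilbert I j + affineHilbert I (regIndex I - 1 - j) =
      Module.finrank K (MvPolynomial (Fin n) K ⧸ I) := by
  set total : ℤ → ℤ := fun j => affineHilbert I j + affineHilbert I (regIndex I - 1 - j)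
  have castelnuovo_eq_iff (j : ℤ) :
      castelnuovo I (regIndex I - (j + 1)) = castelnuovo I (j + 1) ↔ total (j + 1) = total j := by
    have h₁ : regIndex I - 1 - (j + 1) = regIndex I - (j + 1) - 1 := by ring
    have h₂ : regIndex I - 1 - j = regIndex I - (j + 1) := by ring
    simp only [castelnuovo, total, h₁, h₂, add_sub_cancel_right]
    constructor <;> intro h <;> linarith
  have total_neg_one : total (-1) = Module.finrank K (MvPolynomial (Fin n) K ⧸ I) := by
    simp only [total, sub_neg_eq_add, sub_add_cancel]
    rw [affineHilbert_of_neg I (by norm_num), zero_add,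
      affineHilbert_eq_finrank_iff.mpr (degFiltration_regIndex I)]
  constructor
  · intro h j
    have periodic : Function.Periodic total 1 := fun j => (castelnuovo_eq_iff j).mp (h (j + 1))
    have total_eq (j : ℤ) : total j = total 0 := by simpa using periodic.int_mul_eq j
    exact (total_eq j).trans ((total_eq (-1)).symm.trans total_neg_one)
  · intro h i
    obtain ⟨j, rfl⟩ : ∃ j, i = j + 1 := ⟨i - 1, by ring⟩
    exact (castelnuovo_eq_iff j).mpr ((h _).trans (h _).symm)

theorem hasPerfectPairing_iff_hasSymmetricAffineHilbert
    {φ : (MvPolynomial (Fin n) K ⧸ I) →ₗ[K] K}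
    (hφ : LinearMap.ker φ = degFiltration I (regIndex I - 1))
    (hideal : ContainsNoIdeal (LinearMap.ker φ)) :
    HasPerfectPairing I ↔ HasSymmetricAffineHilbert I := by
  rw [hasPerfectPairing_iff_orthogonal_le hφ, hasSymmetricAffineHilbert_iff]
  refine forall_congr' fun j => ?_
  have le_orthogonal : degFiltration I (regIndex I - 1 - j) ≤
      (mulForm φ).orthogonal (degFiltration I j) := by
    intro x hx
    rw [mem_orthogonal_mulForm, hφ]
    intro y hy
    simpa using mul_mem_degFiltration I hx hy
  have finrank_orthogonal := LinearMap.BilinForm.finrank_orthogonal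
    hideal.nondegenerate_mulForm (degFiltration I j)
  have finrank_le := (degFiltration I j).finrank_le
  calc (mulForm φ).orthogonal (degFiltration I j) ≤ degFiltration I (regIndex I - 1 - j)
      ↔ Module.finrank K ((mulForm φ).orthogonal (degFiltration I j)) =
          Module.finrank K (degFiltration I (regIndex I - 1 - j)) :=
        ⟨fun h => by rw [h.antisymm le_orthogonal],
          fun h => (Submodule.eq_of_le_of_finrank_eq le_orthogonal h.symm).ge⟩
    _ ↔ affineHilbert I j + affineHilbert I (regIndex I - 1 - j) =
          Module.finrank K (MvPolynomial (Fin n) K ⧸ I) := by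
        simp only [affineHilbert, finrank_orthogonal]
        omega

end Symmetric

end Pairing

/-! ### Socles of connected graded algebras -/

section ConnectedGraded

variable {K : Type*} [Field K] {A : ℤ → Type*} [∀ i, AddCommGroup (A i)]

/-- The element `u` of a graded ring has no component of degree less than `k`. -/
def VanishesBelow (k : ℤ) (u : ⨁ i, A i) : Prop := ∀ j < k, u j = 0

theorem vanishesBelow_of (k : ℤ) (a : A k) : VanishesBelow k (DirectSum.of A k a) :=
  fun _ hj => DirectSum.of_eq_of_ne _ _ _ hj.ne

theorem VanishesBelow.mono {k l : ℤ} {u : ⨁ i, A i} (hkl : k ≤ l) (hu : VanishesBelow l u) :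
    VanishesBelow k u := fun j hj => hu j (hj.trans_le hkl)

variable [DirectSum.GCommRing A]

theorem of_mul_of_apply (i j : ℤ) (a : A i) (u : ⨁ i, A i) :
    DirectSum.of A i a * DirectSum.of A j (u j) =
      DirectSum.of A (i + j) ((DirectSum.of A i a * u) (i + j)) := by
  induction u using DirectSum.induction_on with
  | zero => simp only [DirectSum.zero_apply, map_zero, mul_zero]
  | add u v hu hv => simp only [DirectSum.add_apply, map_add, mul_add, hu, hv]
  | of k b =>
    rcases eq_or_ne k j with rfl | hkj
    · rw [DirectSum.of_eq_same, DirectSum.of_mul_of, DirectSum.of_eq_same]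
    · rw [DirectSum.of_eq_of_ne _ _ _ hkj.symm, map_zero, mul_zero, DirectSum.of_mul_of,
        DirectSum.of_eq_of_ne _ _ _ (by omega), map_zero]

theorem VanishesBelow.mul {k l : ℤ} {u v : ⨁ i, A i} (hu : VanishesBelow k u)
    (hv : VanishesBelow l v) : VanishesBelow (k + l) (u * v) := by
  classical
  intro d hd
  rw [← DirectSum.sum_support_of u, Finset.sum_mul, DFinsupp.finsetSum_apply]
  refine Finset.sum_eq_zero fun i _ => ?_
  obtain ⟨e, rfl⟩ : ∃ e, d = i + e := ⟨d - i, by ring⟩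
  refine DirectSum.of_injective (i + e) ?_
  rw [← of_mul_of_apply, map_zero]
  rcases lt_or_ge i k with hi | hi
  · rw [hu i hi, map_zero, zero_mul]
  · rw [hv e (by omega), map_zero, mul_zero]

variable [∀ i, Module K (A i)]

variable (K A) in
/-- The graded `K`-algebra `A` is concentrated in degrees `0, …, r`, with `A 0` spanned by `1` over
`K` and `A r` nonzero. -/
structure IsConnectedOfTopDegree (r : ℤ) : Prop where
  subsingleton_of_neg : ∀ i < 0, Subsingleton (A i)
  exists_smul_one : ∀ a : A 0, ∃ c : K, c • (GradedMonoid.GOne.one : A 0) = a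
  nontrivial_top : Nontrivial (A r)
  subsingleton_of_top_lt : ∀ i, r < i → Subsingleton (A i)

namespace IsConnectedOfTopDegree

variable {r : ℤ}

theorem vanishesBelow_zero (h : IsConnectedOfTopDegree K A r) (u : ⨁ i, A i) :
    VanishesBelow 0 u := fun j hj =>
  (h.subsingleton_of_neg j hj).elim _ _

theorem vanishesBelow_one_iff (h : IsConnectedOfTopDegree K A r) {u : ⨁ i, A i} :
    VanishesBelow 1 u ↔ u 0 = 0 := by
  refine ⟨fun hu => hu 0 one_pos, fun hu j hj => ?_⟩
  rcases (show j ≤ 0 by omega).lt_or_eq with hneg | rfl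
  · exact h.vanishesBelow_zero u j hneg
  · exact hu

theorem vanishesBelow_pow (h : IsConnectedOfTopDegree K A r)
    {u : ⨁ i, A i} (hu : VanishesBelow 1 u) (k : ℕ) : VanishesBelow k (u ^ k) := by
  induction k with
  | zero => exact h.vanishesBelow_zero _
  | succ k ih => exact pow_succ u k ▸ Nat.cast_succ (R := ℤ) k ▸ ih.mul hu

theorem eq_zero_of_vanishesBelow (h : IsConnectedOfTopDegree K A r)
    {k : ℤ} (hk : r < k) {u : ⨁ i, A i} (hu : VanishesBelow k u) : u = 0 := by
  refine DFinsupp.ext fun j => ?_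
  rcases lt_or_ge j k with hj | hj
  · exact hu j hj
  · exact (h.subsingleton_of_top_lt j (hk.trans_le hj)).elim _ _

theorem eq_of_apply_top (h : IsConnectedOfTopDegree K A r) {u : ⨁ i, A i} (hu : VanishesBelow r u) :
    u = DirectSum.of A r (u r) := by
  refine DFinsupp.ext fun j => ?_
  rcases lt_trichotomy j r with hj | rfl | hj
  · rw [hu j hj, DirectSum.of_eq_of_ne _ _ _ hj.ne]
  · exact (DirectSum.of_eq_same _ _).symm
  · exact (h.subsingleton_of_top_lt j hj).elim _ _

theorem isNilpotent_of_apply_zero (h : IsConnectedOfTopDegree K A r) {u : ⨁ i, A i}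
    (hu : u 0 = 0) : IsNilpotent u :=
  ⟨r.toNat + 1, h.eq_zero_of_vanishesBelow (by omega)
    (h.vanishesBelow_pow (h.vanishesBelow_one_iff.mpr hu) _)⟩

theorem exists_of_top_ne_zero (h : IsConnectedOfTopDegree K A r) :
    ∃ ω : A r, DirectSum.of A r ω ≠ 0 := by
  have := h.nontrivial_top
  obtain ⟨ω, hω⟩ := exists_ne (0 : A r)
  exact ⟨ω, (map_ne_zero_iff _ (DirectSum.of_injective r)).mpr hω⟩

theorem nontrivial (h : IsConnectedOfTopDegree K A r) : Nontrivial (⨁ i, A i) :=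
  have ⟨_, hω⟩ := h.exists_of_top_ne_zero
  nontrivial_of_ne _ _ hω

theorem exists_smul_one_apply_zero (h : IsConnectedOfTopDegree K A r) (u : ⨁ i, A i) :
    ∃ c : K, (u - c • 1) 0 = 0 := by
  obtain ⟨c, hc⟩ := h.exists_smul_one (u 0)
  refine ⟨c, ?_⟩
  rw [DirectSum.sub_apply, DirectSum.smul_apply, DirectSum.one_def, DirectSum.of_eq_same, hc,
    sub_self]

variable [DirectSum.GAlgebra K A]

theorem isUnit_iff (h : IsConnectedOfTopDegree K A r) {u : ⨁ i, A i} : IsUnit u ↔ u 0 ≠ 0 := by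
  have := h.nontrivial
  refine ⟨fun hu hu0 => (h.isNilpotent_of_apply_zero hu0).not_isUnit hu, fun hu => ?_⟩
  obtain ⟨c, hc⟩ := h.exists_smul_one_apply_zero u
  have hc0 : c ≠ 0 := by
    rintro rfl
    rw [zero_smul, sub_zero] at hc
    exact hu hc
  rw [← sub_add_cancel u (c • 1)]
  exact (h.isNilpotent_of_apply_zero hc).isUnit_add_right_of_commute
    (isUnit_one.smul (Units.mk0 c hc0)) (Commute.all _ _)

theorem isLocalRing (h : IsConnectedOfTopDegree K A r) : IsLocalRing (⨁ i, A i) := by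
  have := h.nontrivial
  refine IsLocalRing.of_nonunits_add fun u v hu hv => ?_
  rw [mem_nonunits_iff, h.isUnit_iff, not_not] at hu hv ⊢
  rw [DirectSum.add_apply, hu, hv, add_zero]

theorem mem_maximalIdeal_iff (h : IsConnectedOfTopDegree K A r) [IsLocalRing (⨁ i, A i)]
    {u : ⨁ i, A i} : u ∈ IsLocalRing.maximalIdeal (⨁ i, A i) ↔ VanishesBelow 1 u := by
  rw [IsLocalRing.mem_maximalIdeal, mem_nonunits_iff, h.isUnit_iff, not_not,
    h.vanishesBelow_one_iff]

theorem of_top_mem_annihilator (h : IsConnectedOfTopDegree K A r) [IsLocalRing (⨁ i, A i)]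
    (ω : A r) : DirectSum.of A r ω ∈ (IsLocalRing.maximalIdeal (⨁ i, A i)).annihilator := by
  refine Submodule.mem_annihilator.mpr fun u hu => ?_
  exact h.eq_zero_of_vanishesBelow (lt_add_one r)
    ((vanishesBelow_of r ω).mul (h.mem_maximalIdeal_iff.mp hu))

theorem mem_span_of_top_iff (h : IsConnectedOfTopDegree K A r) {ω : A r} {u : ⨁ i, A i} :
    u ∈ Ideal.span {DirectSum.of A r ω} ↔ ∃ c : K, DirectSum.of A r (c • ω) = u := by
  have of_smul (c : K) : DirectSum.of A r (c • ω) = c • DirectSum.of A r ω :=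
    map_smul (DirectSum.lof K ℤ A r) c ω
  have := h.isLocalRing
  rw [Ideal.mem_span_singleton']
  constructor
  · rintro ⟨v, rfl⟩
    obtain ⟨c, hc⟩ := h.exists_smul_one_apply_zero v
    have hsocle := Submodule.mem_annihilator.mp (h.of_top_mem_annihilator ω) (v - c • 1)
      (h.mem_maximalIdeal_iff.mpr (h.vanishesBelow_one_iff.mpr hc))
    refine ⟨c, ?_⟩
    rw [smul_eq_mul, mul_comm, sub_mul, smul_one_mul, sub_eq_zero] at hsocle
    rw [hsocle, of_smul]
  · rintro ⟨c, rfl⟩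
    exact ⟨c • 1, by rw [of_smul, smul_one_mul]⟩

theorem exists_mul_mem_annihilator (h : IsConnectedOfTopDegree K A r) [IsLocalRing (⨁ i, A i)]
    {u : ⨁ i, A i} (hu : u ≠ 0) :
    ∃ v, u * v ≠ 0 ∧ u * v ∈ (IsLocalRing.maximalIdeal (⨁ i, A i)).annihilator := by
  -- A nonzero multiple of `u` that starts in the highest possible degree is killed by `𝔪`.
  obtain ⟨k, ⟨v, huv, hk⟩, hmax⟩ := Int.exists_greatest_of_bdd
    (P := fun k => ∃ v, u * v ≠ 0 ∧ VanishesBelow k (u * v))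
    ⟨r, fun k ⟨v, huv, hk⟩ => not_lt.mp fun hrk => huv (h.eq_zero_of_vanishesBelow hrk hk)⟩
    ⟨0, 1, by rwa [mul_one], h.vanishesBelow_zero _⟩
  refine ⟨v, huv, Submodule.mem_annihilator.mpr fun a ha => ?_⟩
  by_contra hne
  rw [smul_eq_mul, mul_assoc] at hne
  have hle := hmax (k + 1)
    ⟨v * a, hne, mul_assoc u v a ▸ hk.mul (h.mem_maximalIdeal_iff.mp ha)⟩
  omega

theorem exists_of_mul_of_ne_zero (h : IsConnectedOfTopDegree K A r) [IsLocalRing (⨁ i, A i)]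
    {ω : A r} (hω : (IsLocalRing.maximalIdeal (⨁ i, A i)).annihilator ≤
      Ideal.span {DirectSum.of A r ω})
    {j : ℤ} {a : A j} (ha : a ≠ 0) :
    ∃ b : A (r - j), DirectSum.of A j a * DirectSum.of A (r - j) b ≠ 0 := by
  obtain ⟨u, hu, hann⟩ := h.exists_mul_mem_annihilator
    ((map_ne_zero_iff _ (DirectSum.of_injective j)).mpr ha)
  obtain ⟨c, hc⟩ := h.mem_span_of_top_iff.mp (hω hann)
  refine ⟨u (r - j), ?_⟩
  rwa [of_mul_of_apply, add_sub_cancel, ← hc, DirectSum.of_eq_same, hc]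

theorem annihilator_le_span_of_top (h : IsConnectedOfTopDegree K A r) [IsLocalRing (⨁ i, A i)]
    (hmul : ∀ j (a : A j), a ≠ 0 →
      ∃ b : A (r - j), DirectSum.of A j a * DirectSum.of A (r - j) b ≠ 0)
    {ω : A r} (hω : ∀ a : A r, ∃ c : K, c • ω = a) :
    (IsLocalRing.maximalIdeal (⨁ i, A i)).annihilator ≤ Ideal.span {DirectSum.of A r ω} := by
  intro u hu
  have vanishesBelow : VanishesBelow r u := by
    intro j hj
    by_contra hne
    obtain ⟨b, hb⟩ := hmul j (u j) hne
    have hbm : DirectSum.of A (r - j) b ∈ IsLocalRing.maximalIdeal (⨁ i, A i) :=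
      h.mem_maximalIdeal_iff.mpr ((vanishesBelow_of (r - j) b).mono (by omega))
    have hbu : DirectSum.of A (r - j) b * u = 0 :=
      (mul_comm _ _).trans (Submodule.mem_annihilator.mp hu _ hbm)
    rw [mul_comm, of_mul_of_apply, hbu, DirectSum.zero_apply, map_zero] at hb
    exact hb rfl
  obtain ⟨c, hc⟩ := hω (u r)
  exact h.mem_span_of_top_iff.mpr ⟨c, hc ▸ (h.eq_of_apply_top vanishesBelow).symm⟩

theorem isZeroDimLocalGorenstein_iff (h : IsConnectedOfTopDegree K A r) :
    IsZeroDimLocalGorenstein (⨁ i, A i) ↔ Module.finrank K (A r) = 1 ∧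
      ∀ j (a : A j), a ≠ 0 →
        ∃ b : A (r - j), DirectSum.of A j a * DirectSum.of A (r - j) b ≠ 0 := by
  have := h.isLocalRing
  obtain ⟨ω, hω⟩ := h.exists_of_top_ne_zero
  have hω0 : ω ≠ 0 := (map_ne_zero_iff _ (DirectSum.of_injective r)).mp hω
  rw [AffineAlgebra.isZeroDimLocalGorenstein_iff (h.of_top_mem_annihilator ω) hω]
  constructor
  · intro hle
    refine ⟨finrank_eq_one ω hω0 fun a => ?_, fun _ _ => h.exists_of_mul_of_ne_zero hle⟩
    obtain ⟨c, hc⟩ := h.mem_span_of_top_iff.mp (hle (h.of_top_mem_annihilator a))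
    exact ⟨c, DirectSum.of_injective r hc⟩
  · rintro ⟨hdim, hmul⟩
    exact h.annihilator_le_span_of_top hmul ((finrank_eq_one_iff_of_nonzero' ω hω0).mp hdim)

end IsConnectedOfTopDegree

end ConnectedGraded

/-! ### Strict Gorenstein rings -/

section StrictGorenstein

variable {K : Type*} [Field K] {n : ℕ} (I : Ideal (MvPolynomial (Fin n) K))

theorem algebraMap_mem_degFiltration (c : K) :
    algebraMap K (MvPolynomial (Fin n) K ⧸ I) c ∈ degFiltration I 0 :=
  Algebra.algebraMap_eq_smul_one (A := MvPolynomial (Fin n) K ⧸ I) c ▸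
    Submodule.smul_mem _ c (one_mem_degFiltration I)

instance grGAlgebra : DirectSum.GAlgebra K (GrPiece I) where
  toFun := (GrPiece.mk I 0 ∘ₗ
    (Algebra.linearMap K (MvPolynomial (Fin n) K ⧸ I)).codRestrict (degFiltration I 0)
      (algebraMap_mem_degFiltration I)).toAddMonoidHom
  map_one := congrArg (GrPiece.mk I 0)
    (Subtype.ext (map_one (algebraMap K (MvPolynomial (Fin n) K ⧸ I))))
  map_mul c d := gradedMk_eq I (add_zero 0).symm
    (map_mul (algebraMap K (MvPolynomial (Fin n) K ⧸ I)) c d)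
  commutes := by
    rintro c ⟨i, a⟩
    obtain ⟨f, rfl⟩ := GrPiece.mk_surjective I _ a
    exact gradedMk_eq I (add_comm 0 i) (mul_comm _ f.1)
  smul_def := by
    rintro c ⟨i, a⟩
    obtain ⟨f, rfl⟩ := GrPiece.mk_surjective I _ a
    exact gradedMk_eq I (zero_add i).symm (Algebra.smul_def c f.1)

theorem subsingleton_grPiece_iff {i : ℤ} :
    Subsingleton (GrPiece I i) ↔ degFiltration I i ≤ degFiltration I (i - 1) :=
  Submodule.Quotient.subsingleton_iff.trans Submodule.submoduleOf_eq_top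

theorem finrank_grPiece [Module.Finite K (MvPolynomial (Fin n) K ⧸ I)] (i : ℤ) :
    (Module.finrank K (GrPiece I i) : ℤ) = castelnuovo I i := by
  have hle : degFiltration I (i - 1) ≤ degFiltration I i := degFiltration_mono I (by omega)
  have hadd := ((degFiltration I (i - 1)).submoduleOf
    (degFiltration I i)).finrank_quotient_add_finrank
  rw [(Submodule.submoduleOfEquivOfLe hle).finrank_eq] at hadd
  rw [castelnuovo, affineHilbert, affineHilbert, ← hadd, Nat.cast_add, add_sub_cancel_right]
  rfl

theorem of_mul_of_ne_zero_iff {i j : ℤ} (f : degFiltration I i) (g : degFiltration I j) :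
    DirectSum.of (GrPiece I) i (GrPiece.mk I i f) * DirectSum.of (GrPiece I) j (GrPiece.mk I j g)
      ≠ 0 ↔ f.1 * g.1 ∉ degFiltration I (i + j - 1) := by
  rw [DirectSum.of_mul_of, map_ne_zero_iff _ (DirectSum.of_injective _)]
  exact (GrPiece.mk_eq_zero_iff I _).not

theorem isConnectedOfTopDegree_grPiece [Module.Finite K (MvPolynomial (Fin n) K ⧸ I)]
    [Nontrivial (MvPolynomial (Fin n) K ⧸ I)] :
    IsConnectedOfTopDegree K (GrPiece I) (regIndex I) where
  subsingleton_of_neg i hi := by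
    rw [subsingleton_grPiece_iff, degFiltration_eq_bot I hi]
    exact bot_le
  exists_smul_one a := by
    obtain ⟨⟨f, hf⟩, rfl⟩ := GrPiece.mk_surjective I 0 a
    rw [degFiltration_zero_eq_span, Submodule.mem_span_singleton] at hf
    obtain ⟨c, rfl⟩ := hf
    exact ⟨c, (map_smul (GrPiece.mk I 0) c _).symm⟩
  nontrivial_top := by
    rw [← not_subsingleton_iff_nontrivial, subsingleton_grPiece_iff, degFiltration_regIndex,
      top_le_iff, degFiltration_eq_top_iff]
    omega
  subsingleton_of_top_lt i hi := by
    rw [subsingleton_grPiece_iff, degFiltration_eq_top_iff.mpr (Int.le_sub_one_of_lt hi)]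
    exact le_top

variable {I}

theorem hasPerfectPairing_iff_exists_of_mul_of_ne_zero : HasPerfectPairing I ↔
    ∀ j (a : GrPiece I j), a ≠ 0 → ∃ b : GrPiece I (regIndex I - j),
      DirectSum.of (GrPiece I) j a * DirectSum.of (GrPiece I) (regIndex I - j) b ≠ 0 := by
  have pairing_iff (j : ℤ) : (∀ a : GrPiece I j, a ≠ 0 → ∃ b : GrPiece I (regIndex I - j),
        DirectSum.of (GrPiece I) j a * DirectSum.of (GrPiece I) (regIndex I - j) b ≠ 0) ↔
      ∀ x ∈ degFiltration I j, (∀ y ∈ degFiltration I (regIndex I - j),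
        x * y ∈ degFiltration I (regIndex I - 1)) → x ∈ degFiltration I (j - 1) := by
    rw [(GrPiece.mk_surjective I j).forall]
    simp only [(GrPiece.mk_surjective I (regIndex I - j)).exists, of_mul_of_ne_zero_iff, ne_eq,
      GrPiece.mk_eq_zero_iff, add_sub_cancel, Subtype.forall, Subtype.exists, exists_prop]
    refine forall₂_congr fun x _ => ?_
    rw [not_imp_comm]
    push Not
    rfl
  simp only [pairing_iff]
  constructor
  · intro h j x _ hx
    have := h (regIndex I - j) x hx
    rwa [show regIndex I - 1 - (regIndex I - j) = j - 1 by ring] at this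
  · intro h j x hx
    by_contra hxj
    have hx0 : x ≠ 0 := fun h0 => hxj (h0 ▸ zero_mem _)
    rw [← filtOrder_le_iff hx0, not_le] at hxj
    have hle : filtOrder I x ≤ filtOrder I x - 1 :=
      (filtOrder_le_iff hx0).mpr <| h _ x ((filtOrder_le_iff hx0).mp le_rfl) fun y hy =>
        hx y (degFiltration_mono I (by omega) hy)
    omega

theorem isStrictGorenstein_iff [Module.Finite K (MvPolynomial (Fin n) K ⧸ I)]
    [Nontrivial (MvPolynomial (Fin n) K ⧸ I)] :
    IsStrictGorenstein I ↔ castelnuovo I (regIndex I) = 1 ∧ HasPerfectPairing I := by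
  rw [IsStrictGorenstein, (isConnectedOfTopDegree_grPiece I).isZeroDimLocalGorenstein_iff,
    hasPerfectPairing_iff_exists_of_mul_of_ne_zero, ← finrank_grPiece, Nat.cast_eq_one]

end StrictGorenstein

theorem nontrivial_of_ringKrullDim_eq_zero {R : Type*} [CommRing R] (h : ringKrullDim R = 0) :
    Nontrivial R := by
  rw [← not_subsingleton_iff_nontrivial]
  intro
  exact WithBot.bot_ne_zero (ringKrullDim_eq_bot_of_subsingleton.symm.trans h)

end AffineAlgebra

end

theorem theorem6p7 {K : Type*} [Field K] {n : ℕ} (I : Ideal (MvPolynomial (Fin n) K))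
    (hI : ringKrullDim (MvPolynomial (Fin n) K ⧸ I) = 0) :
    (AffineAlgebra.IsStrictGorenstein I ↔
      AffineAlgebra.HasCBP I ∧ AffineAlgebra.HasSymmetricAffineHilbert I) ∧
    (AffineAlgebra.IsStrictGorenstein I →
      AffineAlgebra.IsLocallyGorenstein (MvPolynomial (Fin n) K ⧸ I)) := by
  have := AffineAlgebra.nontrivial_of_ringKrullDim_eq_zero hI
  have : Module.Finite K (MvPolynomial (Fin n) K ⧸ I) :=
    (Module.finite_iff_krullDimLE_zero K _).mpr (Ring.krullDimLE_iff.mpr hI.le)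
  rw [AffineAlgebra.isStrictGorenstein_iff, AffineAlgebra.hasCBP_iff]
  refine ⟨⟨fun ⟨hdim, hpair⟩ => ?_, fun ⟨hcbp, hsymm⟩ => ?_⟩, fun ⟨hdim, hpair⟩ => ?_⟩
  · obtain ⟨φ, hφ⟩ := AffineAlgebra.exists_ker_eq_degFiltration hdim
    have hideal := hpair.containsNoIdeal
    exact ⟨hideal, (AffineAlgebra.hasPerfectPairing_iff_hasSymmetricAffineHilbert hφ
      (hφ ▸ hideal)).mp hpair⟩
  · have hdim := hsymm.castelnuovo_regIndex_eq_one
    obtain ⟨φ, hφ⟩ := AffineAlgebra.exists_ker_eq_degFiltration hdim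
    exact ⟨hdim, (AffineAlgebra.hasPerfectPairing_iff_hasSymmetricAffineHilbert hφ
      (hφ ▸ hcbp)).mpr hsymm⟩
  · obtain ⟨φ, hφ⟩ := AffineAlgebra.exists_ker_eq_degFiltration hdim
    exact AffineAlgebra.ContainsNoIdeal.isLocallyGorenstein (hφ ▸ hpair.containsNoIdeal)
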